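/- Let $St(d,k)=\{U\in\mathbb R^{d\times k}: U^TU=I\}$ and, for matrices $U,X$ of equal size, $\mathcal P_{\mathcal T_U}(X)=X-\tfrac12U(U^TX+X^TU)$; $\|\cdot\|_F$ is the Frobenius norm. A map $\mathcal{GR}_U(\xi)\in St(d,k)$ ($U\in St(d,k)$, $\xi\in\mathbb R^{d\times k}$) is a generalized retraction with constants $M_1,M_2\ge0$, $M_3>0$ if (1) $\mathrm{col}(\mathcal{GR}_U(\xi))=\mathrm{col}(U+\xi)$ whenever $U+\xi$ has full column rank, and (2) $\|\mathcal{GR}_U(\xi)-(U+\mathcal P_{\mathcal T_U}(\xi))\|_F\le M_1\|\mathcal P_{\mathcal T_U}(\xi)\|_F^2+M_2\|\xi-\mathcal P_{\mathcal T_U}(\xi)\|_F$ whenever $\|\xi\|_F\le M_3$. Let $S_{(1)},\dots,S_{(N)}\in\mathbb R^{d\times d}$ ($N\ge1$) be symmetric positive semidefinite with $\|S_{(i)}\|_{op}\le G_{\max}$, $G_{\max}>0$. Fix ranks $r_1,r_{2,(1)},\dots,r_{2,(N)}$ and set $r=\max\{r_1,r_{2,(1)},\dots,r_{2,(N)}\}$;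 let $\mathcal{GR}$ be a generalized retraction with constants $M_1,M_2,M_3$ for each of these ranks $k$. PerPCA (choice 1, constant stepsize $\eta$) starts from $U_1\in St(d,r_1)$ and $V_{(i),1/2}\in St(d,r_{2,(i)})$ and in each round $\tau=1,2,\dots$ computes, for each $i$, $$V_{(i),\tau}=\mathcal{GR}_{V_{(i),\tau-1/2}}\big(-U_\tau U_\tau^TV_{(i),\tau-1/2}\big),\qquad g_{(i),\tau}=\mathcal P_{\mathcal T_{[U_\tau,V_{(i),\tau}]}}\big(S_{(i)}[U_\tau,V_{(i),\tau}]\big),$$ writes $g_{(i),\tau}=[g^U_{(i),\tau},g^V_{(i),\tau}]$ (first $r_1$ and last $r_{2,(i)}$ columns), and sets $$U_{(i),\tau+1}=U_\tau+\eta g^U_{(i),\tau},\qquad V_{(i),\tau+1/2}=\mathcal{GR}_{V_{(i),\tau}}\big(\eta g^V_{(i),\tau}\big),\qquad U_{\tau+1}=\mathcal{GR}_{U_\tau}\Big(\tfrac1N\sum_{i=1}^NU_{(i),\tau+1}-U_\tau\Big).$$ Theorem. There is a constant $c>0$ depending only on $M_1,M_2,M_3$ such that for every constant stepsize $0<\eta\le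 \dfrac{c}{G_{\max}\sqrt r}$ there is a constant $C$, depending only on $M_1,M_2,M_3,d,N,r_1,(r_{2,(i)})_i,G_{\max},\eta$, for which the following holds for every such choice of the $S_{(i)}$ and of $\mathcal{GR}$ and every initialization such that, for each $i$, the columns of $[U_1,V_{(i),1/2}]$ are linearly independent. All iterates are feasible, that is $[U_\tau,V_{(i),\tau}]\in St(d,r_1+r_{2,(i)})$ for all $\tau$ and $i$, and the violation of the KKT conditions of $\max \frac12\sum_i[\mathrm{tr}(U^TS_{(i)}U)+\mathrm{tr}(V_{(i)}^TS_{(i)}V_{(i)})]$ subject to $[U,V_{(i)}]\in St(d,r_1+r_{2,(i)})$ satisfies, with $P_A=AA^T$, for every $R\ge1$, $$\min_{\tau\in\{1,\dots,R\}}\left[\Big\|\sum_{i=1}^N(I-P_{U_\tau}-P_{V_{(i),\tau}})S_{(i)}U_\tau\Big\|_F^2+\sum_{i=1}^N\Big\|(I-P_{U_\tau}-P_{V_{(i),\tau}})S_{(i)}V_{(i),\tau}\Big\|_F^2\right]\le\frac CR .$$ -/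

import Mathlib

open scoped Matrix Matrix.Norms.Frobenius

noncomputable section

namespace PerPCA

/-- The Stiefel manifold: real `d × r` matrices with orthonormal columns. -/
def Stiefel (d : ℕ) (κ : Type*) [Fintype κ] [DecidableEq κ] : Set (Matrix (Fin d) κ ℝ) :=
  {U | Uᵀ * U = 1}

/-- Projection onto the normal space of the Stiefel manifold at `U`. -/
def normalProj {d : ℕ} {κ : Type*} [Fintype κ] (U X : Matrix (Fin d) κ ℝ) :
    Matrix (Fin d) κ ℝ :=
  (1 / 2 : ℝ) • (U * (Uᵀ * X + Xᵀ * U))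

/-- Projection onto the tangent space of the Stiefel manifold at `U`. -/
def tangentProj {d : ℕ} {κ : Type*} [Fintype κ] (U X : Matrix (Fin d) κ ℝ) :
    Matrix (Fin d) κ ℝ :=
  X - normalProj U X

/-- The column space of a matrix. -/
def colSpace {d : ℕ} {κ : Type*} (A : Matrix (Fin d) κ ℝ) : Submodule ℝ (Fin d → ℝ) :=
  Submodule.span ℝ (Set.range A.col)

/-- `gr U ξ` is a generalized retraction on the Stiefel manifold with constants `M₁, M₂, M₃`.
A matrix with orthonormal columns has full column rank, so the column space of `U + ξ` can be
preserved only when the columns of `U + ξ` are linearly independent; it is required in exactly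
that case. All matrix norms are Frobenius norms. -/
structure IsGeneralizedRetraction {d r : ℕ} (M₁ M₂ M₃ : ℝ)
    (gr : Matrix (Fin d) (Fin r) ℝ → Matrix (Fin d) (Fin r) ℝ → Matrix (Fin d) (Fin r) ℝ) :
    Prop where
  mem_stiefel : ∀ U ∈ Stiefel d (Fin r), ∀ ξ, gr U ξ ∈ Stiefel d (Fin r)
  colSpace_eq : ∀ U ∈ Stiefel d (Fin r), ∀ ξ, LinearIndependent ℝ (U + ξ).col →
    colSpace (gr U ξ) = colSpace (U + ξ)
  approx : ∀ U ∈ Stiefel d (Fin r), ∀ ξ, ‖ξ‖ ≤ M₃ →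
    ‖gr U ξ - (U + tangentProj U ξ)‖ ≤
      M₁ * ‖tangentProj U ξ‖ ^ 2 + M₂ * ‖ξ - tangentProj U ξ‖

/-- The operator norm of a square matrix, with respect to the Euclidean norm. -/
def opNorm {d : ℕ} (A : Matrix (Fin d) (Fin d) ℝ) : ℝ :=
  ‖Matrix.toEuclideanCLM (n := Fin d) (𝕜 := ℝ) A‖

/-- The maximal rank `r = max {r₁, r₂₍₁₎, …, r₂₍N₎}`. -/
def maxRank {N : ℕ} (r₁ : ℕ) (r₂ : Fin N → ℕ) : ℕ :=
  max r₁ (Finset.univ.sup r₂)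

/-- The variables at the beginning of communication round `τ`: the global components `U_τ`
and the uncorrected local components `V_{(i), τ - 1/2}`. -/
structure State (d N r₁ : ℕ) (r₂ : Fin N → ℕ) where
  U : Matrix (Fin d) (Fin r₁) ℝ
  Vhalf : (i : Fin N) → Matrix (Fin d) (Fin (r₂ i)) ℝ

section Algorithm

variable {d N r₁ : ℕ} {r₂ : Fin N → ℕ}
  (gr : (k : ℕ) → Matrix (Fin d) (Fin k) ℝ → Matrix (Fin d) (Fin k) ℝ → Matrix (Fin d) (Fin k) ℝ)
  (S : Fin N → Matrix (Fin d) (Fin d) ℝ) (η : ℝ)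

/-- The corrected local components
`V_{(i), τ} = GR_{V_{(i), τ - 1/2}} (- U_τ U_τᵀ V_{(i), τ - 1/2})`. -/
def State.V (x : State d N r₁ r₂) (i : Fin N) : Matrix (Fin d) (Fin (r₂ i)) ℝ :=
  gr (r₂ i) (x.Vhalf i) (-(x.U * x.Uᵀ * x.Vhalf i))

/-- The parallel gradient `g_{(i), τ}`: the projection of `S_{(i)} [U_τ, V_{(i), τ}]` onto the
tangent space at `[U_τ, V_{(i), τ}]`. -/
def State.parallelGrad (x : State d N r₁ r₂) (i : Fin N) :
    Matrix (Fin d) (Fin r₁ ⊕ Fin (r₂ i)) ℝ :=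
  tangentProj (Matrix.fromCols x.U (x.V gr i)) (S i * Matrix.fromCols x.U (x.V gr i))

/-- The client's update of the global components, `U_{(i), τ + 1}`. -/
def State.clientU (x : State d N r₁ r₂) (i : Fin N) : Matrix (Fin d) (Fin r₁) ℝ :=
  x.U + η • (x.parallelGrad gr S i).toCols₁

/-- One communication round of the algorithm with choice 1. -/
def State.next (x : State d N r₁ r₂) : State d N r₁ r₂ where
  U := gr r₁ x.U ((1 / (N : ℝ)) • (∑ i, x.clientU gr S η i) - x.U)
  Vhalf := fun i => gr (r₂ i) (x.V gr i) (η • (x.parallelGrad gr S i).toCols₂)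

/-- The run of the algorithm with constant stepsize `η`: `run gr S η x k` is the state at the
beginning of communication round `τ = k + 1`, and `x` is the initialization. -/
def run (x : State d N r₁ r₂) : ℕ → State d N r₁ r₂
  | 0 => x
  | k + 1 => (run x k).next gr S η

/-- `I - P_{U_τ} - P_{V_{(i), τ}}`. -/
def State.residualProj (x : State d N r₁ r₂) (i : Fin N) : Matrix (Fin d) (Fin d) ℝ :=
  1 - x.U * x.Uᵀ - x.V gr i * (x.V gr i)ᵀ

/-- The squared violation of the stationarity (KKT) conditions in round `τ`. -/
def State.kktViolation (x : State d N r₁ r₂) : ℝ :=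
  ‖∑ i, x.residualProj gr i * S i * x.U‖ ^ 2 +
    ∑ i, ‖x.residualProj gr i * S i * x.V gr i‖ ^ 2

end Algorithm

end PerPCA

end

/-! The sum of the traces $\mathrm{tr}(U^TS_iU)+\mathrm{tr}(V_i^TS_iV_i)$, taken at the corrected
iterates, increases in every round, and the rate follows by telescoping. Write
$a=\eta\cdot$`meanGradU` and $b=\eta\cdot$`gradV`. Up to second-order errors the retractions move
$U$ by $a$ and $V$ by $b$; after that, deflation restores orthogonality by adding $-U a^TV$
(`norm_displacement_sub_le`). This extra shift of $V$ turns the first-order change into the pairing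
of $a$ and $b$ with the residual gradients $(I-P_U-P_V)SU$ and $(I-P_U-P_V)SV$
(`trace_first_order`). Since $S_i\succeq0$, the traces are convex and lie above their linearization
(`trace_quadratic_sub_ge`), so only the displacement errors have to be controlled. They are weighted
by $\|S_iU\|,\|S_iV\|\le G\sqrt r$, and a stepsize of order $1/(G\sqrt r)$ makes them at most half
of the gain. The energy therefore grows by at least $\eta\cdot$`progress` per round
(`next_isFeasible_and_energy`) while staying in $[0,2NGr]$, and `progress` controls the KKT
violation up to the factor $N$. -/

namespace PerPCA

/-! ### Frobenius norm inequalities. -/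

section Frobenius

variable {m n l : Type*} [Fintype m] [Fintype n] [Fintype l]

theorem trace_transpose_mul_eq_sum (A B : Matrix m n ℝ) :
    (Aᵀ * B).trace = ∑ p : n × m, A p.2 p.1 * B p.2 p.1 := by
  simp [Matrix.trace, Matrix.mul_apply, Fintype.sum_prod_type]

theorem frobenius_norm_sq (A : Matrix m n ℝ) : ‖A‖ ^ 2 = (Aᵀ * A).trace := by
  rw [Matrix.frobenius_norm_def, ← Real.sqrt_eq_rpow, Real.sq_sqrt (by positivity),
    trace_transpose_mul_eq_sum, Fintype.sum_prod_type, Finset.sum_comm]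
  simp [pow_two]

theorem abs_trace_transpose_mul_le (A B : Matrix m n ℝ) :
    |(Aᵀ * B).trace| ≤ ‖A‖ * ‖B‖ := by
  refine abs_le_of_sq_le_sq ?_ (by positivity)
  rw [mul_pow, frobenius_norm_sq, frobenius_norm_sq]
  simp only [trace_transpose_mul_eq_sum, ← pow_two]
  exact Finset.sum_mul_sq_le_sq_mul_sq _ _ _

theorem norm_mul_of_orthonormal [DecidableEq n] {U : Matrix m n ℝ} (hU : Uᵀ * U = 1)
    (X : Matrix n l ℝ) : ‖U * X‖ = ‖X‖ := by
  rw [← sq_eq_sq₀ (norm_nonneg _) (norm_nonneg _), frobenius_norm_sq, frobenius_norm_sq,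
    Matrix.transpose_mul, Matrix.mul_assoc, ← Matrix.mul_assoc Uᵀ, hU, Matrix.one_mul]

theorem norm_le_of_sq_le_mul {x y : ℝ} (hx : 0 ≤ x) (hy : 0 ≤ y) (h : x ^ 2 ≤ y * x) :
    x ≤ y := by
  rcases hx.eq_or_lt with rfl | hx
  · exact hy
  · rw [pow_two] at h
    exact le_of_mul_le_mul_right h hx

theorem norm_transpose_mul_le [DecidableEq n] {U : Matrix m n ℝ} (hU : Uᵀ * U = 1)
    (X : Matrix m l ℝ) : ‖Uᵀ * X‖ ≤ ‖X‖ := by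
  refine norm_le_of_sq_le_mul (norm_nonneg _) (norm_nonneg _) ?_
  rw [← norm_mul_of_orthonormal hU (Uᵀ * X), frobenius_norm_sq,
    norm_mul_of_orthonormal hU, ← norm_mul_of_orthonormal hU (Uᵀ * X)]
  refine le_trans (le_of_eq ?_) (le_trans (le_abs_self _) (abs_trace_transpose_mul_le _ _))
  simp only [Matrix.transpose_mul, Matrix.transpose_transpose, Matrix.mul_assoc]
  rw [← Matrix.mul_assoc Uᵀ U, hU, Matrix.one_mul]

theorem norm_transpose_mul_le' [DecidableEq n] {U : Matrix m n ℝ} (hU : Uᵀ * U = 1)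
    (X : Matrix m l ℝ) : ‖Xᵀ * U‖ ≤ ‖X‖ := by
  rw [← Matrix.frobenius_norm_transpose, Matrix.transpose_mul, Matrix.transpose_transpose]
  exact norm_transpose_mul_le hU X

theorem norm_mul_le_of_isProj {Q : Matrix m m ℝ} (hs : Qᵀ = Q) (hi : Q * Q = Q)
    (X : Matrix m l ℝ) : ‖Q * X‖ ≤ ‖X‖ := by
  refine norm_le_of_sq_le_mul (norm_nonneg _) (norm_nonneg _) ?_
  rw [frobenius_norm_sq]
  refine le_trans (le_of_eq ?_) (le_trans (le_abs_self _) (abs_trace_transpose_mul_le _ _))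
  rw [Matrix.transpose_mul, hs, Matrix.mul_assoc, ← Matrix.mul_assoc Q, hi]

theorem norm_sq_of_orthonormal [DecidableEq n] {U : Matrix m n ℝ} (hU : Uᵀ * U = 1) :
    ‖U‖ ^ 2 = Fintype.card n := by
  rw [frobenius_norm_sq, hU, Matrix.trace_one]

theorem norm_sq_eq_sum_col (A : Matrix m n ℝ) :
    ‖A‖ ^ 2 = ∑ j, ‖WithLp.toLp 2 (A.col j)‖ ^ 2 := by
  rw [frobenius_norm_sq, trace_transpose_mul_eq_sum, Fintype.sum_prod_type]
  simp only [EuclideanSpace.norm_sq_eq]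
  simp [pow_two]

theorem norm_mulVec_le (A : Matrix m n ℝ) (x : n → ℝ) :
    ‖WithLp.toLp 2 (A *ᵥ x)‖ ≤ ‖A‖ * ‖WithLp.toLp 2 x‖ := by
  have h := Matrix.frobenius_norm_mul A (Matrix.replicateCol Unit x)
  rwa [← Matrix.replicateCol_mulVec, Matrix.frobenius_norm_replicateCol,
    Matrix.frobenius_norm_replicateCol] at h

end Frobenius

/-- Applied column by column. The mixed bound makes $\sqrt r$ the only dimensional factor in the
stepsize condition. -/
theorem norm_mul_le_opNorm {d : ℕ} {n : Type*} [Fintype n] (S : Matrix (Fin d) (Fin d) ℝ)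
    (A : Matrix (Fin d) n ℝ) : ‖S * A‖ ≤ opNorm S * ‖A‖ := by
  have h0 : 0 ≤ opNorm S := norm_nonneg _
  refine le_of_sq_le_sq ?_ (by positivity)
  rw [mul_pow, norm_sq_eq_sum_col, norm_sq_eq_sum_col, Finset.mul_sum]
  refine Finset.sum_le_sum fun j _ => ?_
  rw [← mul_pow]
  have h := (Matrix.toEuclideanCLM (n := Fin d) (𝕜 := ℝ) S).le_opNorm (WithLp.toLp 2 (A.col j))
  exact pow_le_pow_left₀ (norm_nonneg _) h 2

end PerPCA

namespace PerPCA

/-! ### Deflation and orthogonality of $U$ and $V$. -/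

section Feasibility

variable {d p q : ℕ} {U : Matrix (Fin d) (Fin p) ℝ} {V : Matrix (Fin d) (Fin q) ℝ}

theorem fromCols_mem_stiefel_iff :
    Matrix.fromCols U V ∈ Stiefel d (Fin p ⊕ Fin q) ↔
      Uᵀ * U = 1 ∧ Vᵀ * V = 1 ∧ Uᵀ * V = 0 := by
  have hT : Vᵀ * U = 0 ↔ Uᵀ * V = 0 := by
    rw [← Matrix.transpose_eq_zero, Matrix.transpose_mul, Matrix.transpose_transpose]
  rw [Stiefel, Set.mem_ofPred_eq, Matrix.transpose_fromCols, Matrix.fromRows_mul_fromCols,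
    ← Matrix.fromBlocks_one, Matrix.fromBlocks_inj, hT]
  tauto

theorem linearIndependent_col_iff {m n : Type*} [Fintype m] [Fintype n] (A : Matrix m n ℝ) :
    LinearIndependent ℝ A.col ↔ ∀ x, A *ᵥ x = 0 → x = 0 := by
  rw [← Matrix.mulVec_injective_iff]
  exact injective_iff_map_eq_zero A.mulVecLin

theorem deflation_mulVec (U : Matrix (Fin d) (Fin p) ℝ) (V : Matrix (Fin d) (Fin q) ℝ)
    (x : Fin q → ℝ) (h : (V + -(U * Uᵀ * V)) *ᵥ x = 0) :
    V *ᵥ x = U *ᵥ ((Uᵀ * V) *ᵥ x) := by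
  rw [Matrix.add_mulVec, Matrix.neg_mulVec, add_neg_eq_zero] at h
  rw [h, Matrix.mulVec_mulVec, Matrix.mul_assoc]

/-- With $T=U^TV$, a kernel vector satisfies $x=T^TTx$, which forces $x=0$ because $T^TT$ is a
strict contraction. This serves every round after the initialization. -/
theorem linearIndependent_deflation_of_norm_lt (hV : Vᵀ * V = 1)
    (h : ‖Uᵀ * V‖ < 1) : LinearIndependent ℝ (V + -(U * Uᵀ * V)).col := by
  rw [linearIndependent_col_iff]
  intro x hx
  have h1 := deflation_mulVec U V x hx
  have h2 : x = ((Uᵀ * V)ᵀ * (Uᵀ * V)) *ᵥ x := by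
    have := congrArg (fun y => Vᵀ *ᵥ y) h1
    simp only [Matrix.mulVec_mulVec, hV, Matrix.one_mulVec] at this
    rw [Matrix.transpose_mul, Matrix.transpose_transpose]
    simpa only [Matrix.mul_assoc] using this
  have h3 := norm_mulVec_le ((Uᵀ * V)ᵀ * (Uᵀ * V)) x
  rw [← h2] at h3
  have h4 : ‖(Uᵀ * V)ᵀ * (Uᵀ * V)‖ < 1 := by
    refine (Matrix.frobenius_norm_mul _ _).trans_lt ?_
    rw [Matrix.frobenius_norm_transpose]
    nlinarith [norm_nonneg (Uᵀ * V)]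
  have h5 : ‖WithLp.toLp 2 x‖ = 0 := by
    nlinarith [norm_nonneg (WithLp.toLp 2 x)]
  simpa using h5

/-- A kernel vector $x$ gives the relation $Vx-U(U^TVx)=0$ between the columns of $[U,V]$. This
serves the initialization, where $U^TV$ need not be small. -/
theorem linearIndependent_deflation_of_fromCols
    (h : LinearIndependent ℝ (Matrix.fromCols U V).col) :
    LinearIndependent ℝ (V + -(U * Uᵀ * V)).col := by
  rw [linearIndependent_col_iff] at h ⊢
  intro x hx
  have h1 := deflation_mulVec U V x hx
  have h2 := h (Sum.elim (-((Uᵀ * V) *ᵥ x)) x) (by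
    rw [Matrix.fromCols_mulVec]
    simp [Matrix.mulVec_neg, h1])
  funext j
  exact congrFun h2 (Sum.inr j)

/-- The deflated columns lie in $\ker U^T$, and the retraction keeps their span, so orthogonality to
$U$ is exact. -/
theorem IsGeneralizedRetraction.fromCols_mem_stiefel {M₁ M₂ M₃ : ℝ}
    {gr : Matrix (Fin d) (Fin q) ℝ → Matrix (Fin d) (Fin q) ℝ → Matrix (Fin d) (Fin q) ℝ}
    (hgr : IsGeneralizedRetraction M₁ M₂ M₃ gr) (hU : Uᵀ * U = 1) (hV : Vᵀ * V = 1)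
    (h : LinearIndependent ℝ (V + -(U * Uᵀ * V)).col) :
    Matrix.fromCols U (gr V (-(U * Uᵀ * V))) ∈ Stiefel d (Fin p ⊕ Fin q) := by
  refine fromCols_mem_stiefel_iff.2 ⟨hU, hgr.mem_stiefel V hV _, ?_⟩
  have hle : colSpace (V + -(U * Uᵀ * V)) ≤ LinearMap.ker (Uᵀ).mulVecLin := by
    rw [colSpace, Submodule.span_le]
    rintro _ ⟨j, rfl⟩
    have h0 : Uᵀ * (V + -(U * Uᵀ * V)) = 0 := by
      rw [Matrix.mul_add, Matrix.mul_neg, Matrix.mul_assoc, ← Matrix.mul_assoc Uᵀ, hU,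
        Matrix.one_mul, add_neg_cancel]
    funext i
    exact congrFun (congrFun h0 i) j
  rw [← hgr.colSpace_eq V hV _ h] at hle
  ext i j
  exact congrFun (LinearMap.mem_ker.1 (hle (Submodule.subset_span ⟨j, rfl⟩))) i

end Feasibility

/-! ### Second-order accuracy of the retraction steps. -/

section Projections

variable {d : ℕ} {κ : Type*} [Fintype κ]

theorem tangentProj_eq_self {U X : Matrix (Fin d) κ ℝ} (h : Uᵀ * X = 0) :
    tangentProj U X = X := by
  have h' : Xᵀ * U = 0 := by
    rw [← Matrix.transpose_eq_zero, Matrix.transpose_mul, Matrix.transpose_transpose, h]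
  simp [tangentProj, normalProj, h, h']

theorem tangentProj_mul_self {S : Matrix (Fin d) (Fin d) ℝ} (hS : Sᵀ = S)
    (W : Matrix (Fin d) κ ℝ) : tangentProj W (S * W) = (1 - W * Wᵀ) * S * W := by
  rw [tangentProj, normalProj, Matrix.transpose_mul, hS, Matrix.mul_assoc Wᵀ S W,
    ← two_smul ℝ (Wᵀ * (S * W)), Matrix.mul_smul, smul_smul]
  norm_num
  simp only [Matrix.sub_mul, Matrix.one_mul, Matrix.mul_assoc]

theorem IsGeneralizedRetraction.norm_sub_add_le {k : ℕ} {M₁ M₂ M₃ : ℝ}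
    {gr : Matrix (Fin d) (Fin k) ℝ → Matrix (Fin d) (Fin k) ℝ → Matrix (Fin d) (Fin k) ℝ}
    (hgr : IsGeneralizedRetraction M₁ M₂ M₃ gr) {U ξ : Matrix (Fin d) (Fin k) ℝ}
    (hU : Uᵀ * U = 1) (hξ : Uᵀ * ξ = 0) (hM : ‖ξ‖ ≤ M₃) :
    ‖gr U ξ - (U + ξ)‖ ≤ M₁ * ‖ξ‖ ^ 2 := by
  have := hgr.approx U hU ξ hM
  rw [tangentProj_eq_self hξ] at this
  simpa using this

/-- The normal part of $-UT$ at $V$ is $-VT^TT$, already quadratic in $T=U^TV$. It contributes $M_2$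
through the retraction bound and $1$ directly; the tangent part, of norm at most $2\|T\|$,
contributes $4M_1$. -/
theorem IsGeneralizedRetraction.norm_deflation_sub_le {p k : ℕ} {M₁ M₂ M₃ : ℝ} (hM₁ : 0 ≤ M₁)
    (hM₂ : 0 ≤ M₂)
    {gr : Matrix (Fin d) (Fin k) ℝ → Matrix (Fin d) (Fin k) ℝ → Matrix (Fin d) (Fin k) ℝ}
    (hgr : IsGeneralizedRetraction M₁ M₂ M₃ gr) {U : Matrix (Fin d) (Fin p) ℝ}
    {V : Matrix (Fin d) (Fin k) ℝ} (hU : Uᵀ * U = 1) (hV : Vᵀ * V = 1)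
    (hM : ‖Uᵀ * V‖ ≤ M₃) (h1 : ‖Uᵀ * V‖ ≤ 1) :
    ‖gr V (-(U * Uᵀ * V)) - (V - U * (Uᵀ * V))‖ ≤ (4 * M₁ + M₂ + 1) * ‖Uᵀ * V‖ ^ 2 := by
  set ξ := -(U * Uᵀ * V) with hξ
  set T := Uᵀ * V with hT
  have hξT : ξ = -(U * T) := by rw [hξ, hT, Matrix.mul_assoc]
  have hVU : Vᵀ * U = Tᵀ := by rw [hT, Matrix.transpose_mul, Matrix.transpose_transpose]
  have hn : ‖ξ‖ = ‖T‖ := by rw [hξT, norm_neg, norm_mul_of_orthonormal hU]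
  have hN : normalProj V ξ = -(V * (Tᵀ * T)) := by
    rw [normalProj, hξT, Matrix.transpose_neg, Matrix.transpose_mul, Matrix.neg_mul,
      Matrix.mul_neg, ← Matrix.mul_assoc, hVU, Matrix.mul_assoc Tᵀ, ← hT, ← neg_add,
      ← two_smul ℝ (Tᵀ * T), Matrix.mul_neg, Matrix.mul_smul, smul_neg, smul_smul]
    norm_num
  have hNn : ‖normalProj V ξ‖ ≤ ‖T‖ ^ 2 := by
    rw [hN, norm_neg, norm_mul_of_orthonormal hV, pow_two]
    refine (Matrix.frobenius_norm_mul _ _).trans ?_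
    rw [Matrix.frobenius_norm_transpose]
  have hTn : ‖tangentProj V ξ‖ ≤ 2 * ‖T‖ := by
    refine (norm_sub_le _ _).trans ?_
    nlinarith [norm_nonneg T]
  have happ := hgr.approx V hV ξ (hn.trans_le hM)
  have e1 : ξ - tangentProj V ξ = normalProj V ξ := by rw [tangentProj]; abel
  have e2 : gr V ξ - (V - U * T) = (gr V ξ - (V + tangentProj V ξ)) - normalProj V ξ := by
    rw [tangentProj, hξT]; abel
  rw [e1] at happ
  rw [e2]
  refine (norm_sub_le _ _).trans ?_
  have h3 : M₁ * ‖tangentProj V ξ‖ ^ 2 ≤ M₁ * (2 * ‖T‖) ^ 2 := by gcongr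
  have h4 : M₂ * ‖normalProj V ξ‖ ≤ M₂ * ‖T‖ ^ 2 := by gcongr
  linarith

end Projections

/-! ### Displacement of $U$ and $V$ over one round. -/

section Displacement

variable {d p q : ℕ} {U a U' : Matrix (Fin d) (Fin p) ℝ} {V b V' : Matrix (Fin d) (Fin q) ℝ}
  {M : ℝ}

theorem norm_transpose_mul_sub_le (hU : Uᵀ * U = 1) (hV' : V'ᵀ * V' = 1) (hUV : Uᵀ * V = 0)
    (hUb : Uᵀ * b = 0) (ha : ‖a‖ ≤ 1) (hM : 0 ≤ M) (hUa : ‖U' - (U + a)‖ ≤ M * ‖a‖ ^ 2)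
    (hVb : ‖V' - (V + b)‖ ≤ M * ‖b‖ ^ 2) :
    ‖U'ᵀ * V' - aᵀ * V‖ ≤ (1 + 2 * M) * (‖a‖ ^ 2 + ‖b‖ ^ 2) := by
  set e₁ := U' - (U + a) with he₁
  set e₂ := V' - (V + b) with he₂
  -- Pairing $e_1$ with the whole of $V'$, which is orthonormal, bounds the last term by $\|e_1\|$.
  have h : U'ᵀ * V' - aᵀ * V = Uᵀ * e₂ + aᵀ * b + aᵀ * e₂ + e₁ᵀ * V' := by
    have h1 : U' = U + a + e₁ := by rw [he₁]; abel
    have h2 : e₁ᵀ * V' = U'ᵀ * V' - Uᵀ * V' - aᵀ * V' := by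
      rw [h1]; simp only [Matrix.transpose_add, Matrix.add_mul]; abel
    rw [h2, he₂]
    simp only [Matrix.mul_sub, Matrix.mul_add, hUV, hUb]
    abel
  have hab : ‖aᵀ * b‖ ≤ ‖a‖ * ‖b‖ := by
    simpa [Matrix.frobenius_norm_transpose] using Matrix.frobenius_norm_mul aᵀ b
  have hae : ‖aᵀ * e₂‖ ≤ ‖a‖ * ‖e₂‖ := by
    simpa [Matrix.frobenius_norm_transpose] using Matrix.frobenius_norm_mul aᵀ e₂
  have hUe := norm_transpose_mul_le hU e₂
  have heV := norm_transpose_mul_le' hV' e₁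
  have hae' : ‖a‖ * ‖e₂‖ ≤ M * ‖b‖ ^ 2 := by
    nlinarith [norm_nonneg a, norm_nonneg e₂]
  have htri := norm_add₄_le (a := Uᵀ * e₂) (b := aᵀ * b) (c := aᵀ * e₂) (d := e₁ᵀ * V')
  rw [← h] at htri
  nlinarith [sq_nonneg (‖a‖ - ‖b‖), mul_nonneg hM (sq_nonneg ‖a‖)]

/-- The linear bound keeps the deflation within the range of the retraction and preserves rank; the
quadratic one makes its error second order. -/
theorem norm_transpose_mul_le_of_sub_le {K δ : ℝ} (hK : 0 ≤ K) (hδ : δ ≤ 1) (hV : Vᵀ * V = 1)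
    (ha : ‖a‖ ≤ δ) (hb : ‖b‖ ≤ δ)
    (h : ‖U'ᵀ * V' - aᵀ * V‖ ≤ K * (‖a‖ ^ 2 + ‖b‖ ^ 2)) :
    ‖U'ᵀ * V'‖ ≤ δ * (1 + 2 * K) ∧
      ‖U'ᵀ * V'‖ ^ 2 ≤ (2 + 4 * K ^ 2) * (‖a‖ ^ 2 + ‖b‖ ^ 2) := by
  have h1 := norm_transpose_mul_le' hV a
  have h2 : ‖U'ᵀ * V'‖ ≤ ‖a‖ + K * (‖a‖ ^ 2 + ‖b‖ ^ 2) := by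
    have := norm_add_le (U'ᵀ * V' - aᵀ * V) (aᵀ * V)
    rw [sub_add_cancel] at this
    linarith
  have ha0 := norm_nonneg a
  have hb0 := norm_nonneg b
  have hs : ‖a‖ ^ 2 + ‖b‖ ^ 2 ≤ 2 * δ := by nlinarith
  set s := ‖a‖ ^ 2 + ‖b‖ ^ 2 with hs'
  have hs0 : 0 ≤ s := by positivity
  have has : ‖a‖ ^ 2 ≤ s := by rw [hs']; nlinarith
  constructor
  · nlinarith
  · have h3 : ‖U'ᵀ * V'‖ ^ 2 ≤ (‖a‖ + K * s) ^ 2 := by gcongr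
    have h4 : s ^ 2 ≤ 2 * s := by nlinarith
    have h5 : K ^ 2 * s ^ 2 ≤ K ^ 2 * (2 * s) := by gcongr
    nlinarith [sq_nonneg (‖a‖ - K * s)]

/-- The constant of the quadratic error in the displacement of the local components. -/
noncomputable def displacementConst (M₁ M₂ : ℝ) : ℝ :=
  2 + 4 * M₁ + (4 * M₁ + M₂ + 1) * (2 + 4 * (1 + 2 * M₁) ^ 2)

theorem norm_displacement_sub_le {M₁ M₂ : ℝ} (hM₁ : 0 ≤ M₁) (hM₂ : 0 ≤ M₂)
    {V'' : Matrix (Fin d) (Fin q) ℝ} (hU' : U'ᵀ * U' = 1) (hV : Vᵀ * V = 1)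
    (ha : ‖a‖ ≤ 1) (hUa : ‖U' - (U + a)‖ ≤ M₁ * ‖a‖ ^ 2)
    (hVb : ‖V' - (V + b)‖ ≤ M₁ * ‖b‖ ^ 2)
    (hcross : ‖U'ᵀ * V' - aᵀ * V‖ ≤ (1 + 2 * M₁) * (‖a‖ ^ 2 + ‖b‖ ^ 2))
    (hcross2 : ‖U'ᵀ * V'‖ ^ 2 ≤ (2 + 4 * (1 + 2 * M₁) ^ 2) * (‖a‖ ^ 2 + ‖b‖ ^ 2))
    (hV'' : ‖V'' - (V' - U' * (U'ᵀ * V'))‖ ≤ (4 * M₁ + M₂ + 1) * ‖U'ᵀ * V'‖ ^ 2) :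
    ‖V'' - V - (b - U * (aᵀ * V))‖ ≤ displacementConst M₁ M₂ * (‖a‖ ^ 2 + ‖b‖ ^ 2) := by
  set e₁ := U' - (U + a) with he₁
  set e₂ := V' - (V + b) with he₂
  set e₃ := V'' - (V' - U' * (U'ᵀ * V')) with he₃
  -- The four terms are the errors of deflation, of retracting $V$, of replacing $U'^TV'$ by $a^TV$,
  -- and of replacing $U'$ by $U$.
  have h : V'' - V - (b - U * (aᵀ * V)) =
      e₃ + e₂ + (-(U' * (U'ᵀ * V' - aᵀ * V))) + (-((a + e₁) * (aᵀ * V))) := by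
    have h1 : a + e₁ = U' - U := by rw [he₁]; abel
    rw [h1, he₃, he₂, Matrix.sub_mul, Matrix.mul_sub]
    abel
  have h1 := norm_transpose_mul_le' hV a
  have h2 : ‖(a + e₁) * (aᵀ * V)‖ ≤ (1 + M₁) * ‖a‖ ^ 2 := by
    refine (Matrix.frobenius_norm_mul _ _).trans ?_
    have h3 : ‖a + e₁‖ ≤ (1 + M₁) * ‖a‖ := by
      refine (norm_add_le _ _).trans ?_
      nlinarith [norm_nonneg a, mul_nonneg hM₁ (norm_nonneg a)]
    calc _ ≤ ((1 + M₁) * ‖a‖) * ‖a‖ := by gcongr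
      _ = _ := by ring
  have htri := norm_add₄_le (a := e₃) (b := e₂) (c := -(U' * (U'ᵀ * V' - aᵀ * V)))
    (d := -((a + e₁) * (aᵀ * V)))
  rw [← h, norm_neg, norm_neg, norm_mul_of_orthonormal hU'] at htri
  have h4 : (4 * M₁ + M₂ + 1) * ‖U'ᵀ * V'‖ ^ 2 ≤
      (4 * M₁ + M₂ + 1) * ((2 + 4 * (1 + 2 * M₁) ^ 2) * (‖a‖ ^ 2 + ‖b‖ ^ 2)) := by gcongr
  rw [displacementConst]
  nlinarith [sq_nonneg ‖a‖, sq_nonneg ‖b‖, mul_nonneg hM₁ (sq_nonneg ‖a‖),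
    mul_nonneg hM₁ (sq_nonneg ‖b‖)]

/-- Convexity: $\mathrm{tr}((X-Y)^TS(X-Y))\ge0$ is dropped, and Cauchy–Schwarz pays for replacing
$X-Y$ by the model displacement $D$. -/
theorem trace_quadratic_sub_ge {S : Matrix (Fin d) (Fin d) ℝ} (hS : S.PosSemidef) {κ : Type*}
    [Fintype κ] (X Y D : Matrix (Fin d) κ ℝ) :
    2 * ((S * Y)ᵀ * D).trace - 2 * (‖S * Y‖ * ‖X - Y - D‖) ≤
      (Xᵀ * S * X).trace - (Yᵀ * S * Y).trace := by
  have hST : Sᵀ = S := by simpa using hS.isHermitian.eq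
  have h0 : 0 ≤ ((X - Y)ᵀ * S * (X - Y)).trace := by
    simpa using (hS.conjTranspose_mul_mul_same (X - Y)).trace_nonneg
  have h1 : (Xᵀ * S * Y).trace = (Yᵀ * S * X).trace := by
    rw [← Matrix.trace_transpose, Matrix.transpose_mul, Matrix.transpose_mul, hST,
      Matrix.transpose_transpose, Matrix.mul_assoc]
  have h2 : ((S * Y)ᵀ * (X - Y - D)).trace =
      (Yᵀ * S * X).trace - (Yᵀ * S * Y).trace - ((S * Y)ᵀ * D).trace := by
    rw [Matrix.mul_sub, Matrix.mul_sub, Matrix.trace_sub, Matrix.trace_sub,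
      Matrix.transpose_mul S Y, hST]
  have h3 := neg_le_of_abs_le (abs_trace_transpose_mul_le (S * Y) (X - Y - D))
  rw [h2] at h3
  have h4 : ((X - Y)ᵀ * S * (X - Y)).trace = (Xᵀ * S * X).trace - (Xᵀ * S * Y).trace -
      (Yᵀ * S * X).trace + (Yᵀ * S * Y).trace := by
    simp only [Matrix.transpose_sub, Matrix.sub_mul, Matrix.mul_sub, Matrix.trace_sub]
    ring
  linarith

end Displacement

end PerPCA

namespace PerPCA

/-! ### Residual projection and first-order change. -/

section Residual

variable {d p q : ℕ} {U : Matrix (Fin d) (Fin p) ℝ} {V : Matrix (Fin d) (Fin q) ℝ}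

theorem transpose_residual (U : Matrix (Fin d) (Fin p) ℝ) (V : Matrix (Fin d) (Fin q) ℝ) :
    (1 - U * Uᵀ - V * Vᵀ)ᵀ = 1 - U * Uᵀ - V * Vᵀ := by
  simp [Matrix.transpose_mul]

theorem transpose_mul_residual (hW : Matrix.fromCols U V ∈ Stiefel d (Fin p ⊕ Fin q)) :
    Uᵀ * (1 - U * Uᵀ - V * Vᵀ) = 0 ∧ Vᵀ * (1 - U * Uᵀ - V * Vᵀ) = 0 := by
  obtain ⟨hU, hV, hUV⟩ := fromCols_mem_stiefel_iff.1 hW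
  have hVU : Vᵀ * U = 0 := by
    rw [← Matrix.transpose_eq_zero, Matrix.transpose_mul, Matrix.transpose_transpose, hUV]
  constructor <;>
  simp [Matrix.mul_sub, ← Matrix.mul_assoc, hU, hV, hUV, hVU]

theorem residual_mul_residual (hW : Matrix.fromCols U V ∈ Stiefel d (Fin p ⊕ Fin q)) :
    (1 - U * Uᵀ - V * Vᵀ) * (1 - U * Uᵀ - V * Vᵀ) = 1 - U * Uᵀ - V * Vᵀ := by
  obtain ⟨h1, h2⟩ := transpose_mul_residual hW
  rw [Matrix.sub_mul (1 - U * Uᵀ), Matrix.sub_mul 1, Matrix.mul_assoc U, Matrix.mul_assoc V, h1,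
    h2]
  simp

theorem tangentProj_fromCols {S : Matrix (Fin d) (Fin d) ℝ} (hS : Sᵀ = S)
    (U : Matrix (Fin d) (Fin p) ℝ) (V : Matrix (Fin d) (Fin q) ℝ) :
    tangentProj (Matrix.fromCols U V) (S * Matrix.fromCols U V) =
      Matrix.fromCols ((1 - U * Uᵀ - V * Vᵀ) * S * U) ((1 - U * Uᵀ - V * Vᵀ) * S * V) := by
  rw [tangentProj_mul_self hS, Matrix.transpose_fromCols, Matrix.fromCols_mul_fromRows,
    ← sub_sub, Matrix.mul_fromCols]

/-- By cyclicity of the trace, the shift $-U a^TV$ removes exactly the part of $\langle SU,a\rangle$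
along $V$. The parts along $U$, and those of $b$, vanish by tangency. -/
theorem trace_first_order {S : Matrix (Fin d) (Fin d) ℝ} (hS : Sᵀ = S)
    {a : Matrix (Fin d) (Fin p) ℝ} {b : Matrix (Fin d) (Fin q) ℝ} (hUa : Uᵀ * a = 0)
    (hUb : Uᵀ * b = 0) (hVb : Vᵀ * b = 0) :
    ((S * U)ᵀ * a).trace + ((S * V)ᵀ * (b - U * (aᵀ * V))).trace =
      (((1 - U * Uᵀ - V * Vᵀ) * S * U)ᵀ * a).trace +
        (((1 - U * Uᵀ - V * Vᵀ) * S * V)ᵀ * b).trace := by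
  have h1 : ((S * V)ᵀ * (U * (aᵀ * V))).trace = ((S * U)ᵀ * (V * (Vᵀ * a))).trace := by
    rw [← Matrix.trace_transpose]
    simp only [Matrix.transpose_mul, Matrix.transpose_transpose, hS]
    have h := Matrix.trace_mul_comm (Vᵀ * a) (Uᵀ * S * V)
    simp only [Matrix.mul_assoc] at h ⊢
    exact h
  rw [Matrix.mul_assoc _ S U, Matrix.mul_assoc _ S V, Matrix.transpose_mul _ (S * U),
    Matrix.transpose_mul _ (S * V), transpose_residual, Matrix.mul_assoc (S * U)ᵀ,
    Matrix.mul_assoc (S * V)ᵀ]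
  have h2 : (1 - U * Uᵀ - V * Vᵀ) * a = a - V * (Vᵀ * a) := by
    rw [Matrix.sub_mul, Matrix.sub_mul, Matrix.mul_assoc U, hUa]
    simp [Matrix.mul_assoc]
  have h3 : (1 - U * Uᵀ - V * Vᵀ) * b = b := by
    rw [Matrix.sub_mul, Matrix.sub_mul, Matrix.mul_assoc U, hUb, Matrix.mul_assoc V, hVb]
    simp
  rw [h2, h3, Matrix.mul_sub, Matrix.mul_sub, Matrix.trace_sub, Matrix.trace_sub, h1]
  ring

theorem norm_le_sqrt_of_orthonormal {k r : ℕ} (hk : k ≤ r) {A : Matrix (Fin d) (Fin k) ℝ}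
    (hA : Aᵀ * A = 1) : ‖A‖ ≤ √r := by
  refine Real.le_sqrt_of_sq_le ?_
  rw [norm_sq_of_orthonormal hA, Fintype.card_fin]
  exact_mod_cast hk

theorem norm_mul_le_mul_sqrt {k r : ℕ} {G : ℝ} (hk : k ≤ r) {S : Matrix (Fin d) (Fin d) ℝ}
    (hS : opNorm S ≤ G) {A : Matrix (Fin d) (Fin k) ℝ} (hA : Aᵀ * A = 1) :
    ‖S * A‖ ≤ G * √r :=
  (norm_mul_le_opNorm S A).trans
    (mul_le_mul hS (norm_le_sqrt_of_orthonormal hk hA) (norm_nonneg _)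
      ((norm_nonneg _).trans hS))

end Residual

/-- The bound on `η * (G * √r)` under which one communication round increases the objective. -/
noncomputable def stepConst (M₁ M₂ M₃ : ℝ) : ℝ :=
  min 1 M₃ / (2 * (3 + 4 * M₁ + displacementConst M₁ M₂ + M₁))

/-! ### Admissible step sizes. -/

section StepConst

variable {M₁ M₂ M₃ : ℝ}

theorem displacementConst_nonneg (hM₁ : 0 ≤ M₁) (hM₂ : 0 ≤ M₂) :
    0 ≤ displacementConst M₁ M₂ := by
  unfold displacementConst; positivity

theorem stepConst_pos (hM₁ : 0 ≤ M₁) (hM₂ : 0 ≤ M₂) (hM₃ : 0 < M₃) :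
    0 < stepConst M₁ M₂ M₃ := by
  have := displacementConst_nonneg hM₁ hM₂
  unfold stepConst; positivity

/-- In order: $a,b$ lie in the retraction range; so does the deflation; the deflated matrix keeps
full rank; the total error is at most half of the gain; $\|a\|,\|b\|\le1$. -/
theorem stepConst_bounds (hM₁ : 0 ≤ M₁) (hM₂ : 0 ≤ M₂) (hM₃ : 0 < M₃) :
    stepConst M₁ M₂ M₃ ≤ M₃ ∧
    stepConst M₁ M₂ M₃ * (1 + 2 * (1 + 2 * M₁)) ≤ M₃ ∧
    stepConst M₁ M₂ M₃ * (1 + 2 * (1 + 2 * M₁)) < 1 ∧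
    stepConst M₁ M₂ M₃ * (displacementConst M₁ M₂ + M₁) ≤ 1 / 2 ∧
    stepConst M₁ M₂ M₃ ≤ 1 := by
  have hD := displacementConst_nonneg hM₁ hM₂
  have hc := stepConst_pos hM₁ hM₂ hM₃
  have hmul : stepConst M₁ M₂ M₃ * (2 * (3 + 4 * M₁ + displacementConst M₁ M₂ + M₁)) =
      min 1 M₃ := div_mul_cancel₀ _ (by positivity)
  have h1 : min 1 M₃ ≤ 1 := min_le_left _ _
  have h2 : min 1 M₃ ≤ M₃ := min_le_right _ _
  have h3 := mul_nonneg hc.le hD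
  have h4 := mul_nonneg hc.le hM₁
  refine ⟨?_, ?_, ?_, ?_, ?_⟩ <;> nlinarith

end StepConst

/-! ### Ascent of the energy along the algorithm. -/

namespace State

variable {d N r₁ : ℕ} {r₂ : Fin N → ℕ}
  {gr : (k : ℕ) → Matrix (Fin d) (Fin k) ℝ → Matrix (Fin d) (Fin k) ℝ → Matrix (Fin d) (Fin k) ℝ}
  {S : Fin N → Matrix (Fin d) (Fin d) ℝ} {η : ℝ} {x : State d N r₁ r₂}

/-- The feasibility of a state, including that of the uncorrected local components. -/
structure IsFeasible
    (gr : (k : ℕ) → Matrix (Fin d) (Fin k) ℝ → Matrix (Fin d) (Fin k) ℝ →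
      Matrix (Fin d) (Fin k) ℝ) (x : State d N r₁ r₂) : Prop where
  stiefel_U : x.U ∈ Stiefel d (Fin r₁)
  fromCols : ∀ i, Matrix.fromCols x.U (x.V gr i) ∈ Stiefel d (Fin r₁ ⊕ Fin (r₂ i))

variable (gr S) in
/-- The gradient of client `i` with respect to the global components. -/
noncomputable def gradU (x : State d N r₁ r₂) (i : Fin N) : Matrix (Fin d) (Fin r₁) ℝ :=
  x.residualProj gr i * S i * x.U

variable (gr S) in
/-- The gradient of client `i` with respect to its local components. -/
noncomputable def gradV (x : State d N r₁ r₂) (i : Fin N) : Matrix (Fin d) (Fin (r₂ i)) ℝ :=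
  x.residualProj gr i * S i * x.V gr i

variable (gr S) in
/-- The average over the clients of the gradients with respect to the global components. -/
noncomputable def meanGradU (x : State d N r₁ r₂) : Matrix (Fin d) (Fin r₁) ℝ :=
  (1 / (N : ℝ)) • ∑ i, x.gradU gr S i

variable (gr S) in
/-- Twice the objective function. -/
noncomputable def energy (x : State d N r₁ r₂) : ℝ :=
  ∑ i, ((x.Uᵀ * S i * x.U).trace + ((x.V gr i)ᵀ * S i * x.V gr i).trace)

variable (gr S) in
/-- The rate of increase of the objective function along the update direction. -/
noncomputable def progress (x : State d N r₁ r₂) : ℝ :=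
  N * ‖x.meanGradU gr S‖ ^ 2 + ∑ i, ‖x.gradV gr S i‖ ^ 2

theorem parallelGrad_eq (hS : ∀ i, (S i)ᵀ = S i) (i : Fin N) :
    x.parallelGrad gr S i = Matrix.fromCols (x.gradU gr S i) (x.gradV gr S i) :=
  tangentProj_fromCols (hS i) _ _

theorem next_U (hN : 0 < N) (hS : ∀ i, (S i)ᵀ = S i) :
    (x.next gr S η).U = gr r₁ x.U (η • x.meanGradU gr S) := by
  have hN' : (N : ℝ) ≠ 0 := by positivity
  simp only [next, clientU, parallelGrad_eq hS, Matrix.toCols₁_fromCols, meanGradU,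
    Finset.sum_add_distrib, Finset.sum_const, Finset.card_univ, Fintype.card_fin, smul_add,
    ← Finset.smul_sum]
  rw [← Nat.cast_smul_eq_nsmul ℝ N x.U, smul_smul, one_div_mul_cancel hN', one_smul,
    add_sub_cancel_left, smul_comm]

theorem next_Vhalf (hS : ∀ i, (S i)ᵀ = S i) (i : Fin N) :
    (x.next gr S η).Vhalf i = gr (r₂ i) (x.V gr i) (η • x.gradV gr S i) := by
  simp only [next, parallelGrad_eq hS, Matrix.toCols₂_fromCols]

theorem N_smul_meanGradU (hN : 0 < N) : (N : ℝ) • x.meanGradU gr S = ∑ i, x.gradU gr S i := by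
  have hN' : (N : ℝ) ≠ 0 := by positivity
  rw [meanGradU, smul_smul, mul_one_div_cancel hN', one_smul]

theorem kktViolation_le (hN : 0 < N) : x.kktViolation gr S ≤ N * x.progress gr S := by
  have hN' : (1 : ℝ) ≤ N := by exact_mod_cast hN
  have h : x.kktViolation gr S =
      ‖∑ i, x.gradU gr S i‖ ^ 2 + ∑ i, ‖x.gradV gr S i‖ ^ 2 := rfl
  have h0 : 0 ≤ ∑ i, ‖x.gradV gr S i‖ ^ 2 := Finset.sum_nonneg fun i _ => by positivity
  rw [h, ← N_smul_meanGradU hN, norm_smul, Real.norm_natCast, progress]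
  nlinarith

theorem transpose_mul_grad (hx : x.IsFeasible gr) (i : Fin N) :
    x.Uᵀ * x.gradU gr S i = 0 ∧ x.Uᵀ * x.gradV gr S i = 0 ∧
      (x.V gr i)ᵀ * x.gradV gr S i = 0 := by
  obtain ⟨h1, h2⟩ := transpose_mul_residual (hx.fromCols i)
  simp only [gradU, gradV, residualProj, Matrix.mul_assoc _ (S i)]
  refine ⟨?_, ?_, ?_⟩ <;> rw [← Matrix.mul_assoc] <;> simp [h1, h2]

theorem transpose_mul_meanGradU (hx : x.IsFeasible gr) : x.Uᵀ * x.meanGradU gr S = 0 := by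
  rw [meanGradU, Matrix.mul_smul, Matrix.mul_sum,
    Finset.sum_eq_zero fun i _ => (transpose_mul_grad hx i).1, smul_zero]

theorem norm_grad_le {r : ℕ} {G : ℝ} (hr₁ : r₁ ≤ r) (hr₂ : ∀ i, r₂ i ≤ r)
    (hS : ∀ i, opNorm (S i) ≤ G) (hx : x.IsFeasible gr) (i : Fin N) :
    ‖x.gradU gr S i‖ ≤ G * √r ∧ ‖x.gradV gr S i‖ ≤ G * √r := by
  obtain ⟨hU, hV, -⟩ := fromCols_mem_stiefel_iff.1 (hx.fromCols i)
  have hR : ∀ {k : ℕ} (X : Matrix (Fin d) (Fin k) ℝ), ‖x.residualProj gr i * X‖ ≤ ‖X‖ := fun X =>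
    norm_mul_le_of_isProj (transpose_residual _ _) (residual_mul_residual (hx.fromCols i)) X
  rw [gradU, gradV, Matrix.mul_assoc, Matrix.mul_assoc]
  exact ⟨(hR _).trans (norm_mul_le_mul_sqrt hr₁ (hS i) hU),
    (hR _).trans (norm_mul_le_mul_sqrt (hr₂ i) (hS i) hV)⟩

theorem norm_meanGradU_le {r : ℕ} {G : ℝ} (hN : 0 < N) (hr₁ : r₁ ≤ r) (hr₂ : ∀ i, r₂ i ≤ r)
    (hS : ∀ i, opNorm (S i) ≤ G) (hx : x.IsFeasible gr) :
    ‖x.meanGradU gr S‖ ≤ G * √r := by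
  have hN' : (0 : ℝ) < N := by exact_mod_cast hN
  have h := norm_sum_le_of_le Finset.univ fun i _ => (norm_grad_le hr₁ hr₂ hS hx i).1
  rw [← N_smul_meanGradU hN, norm_smul, Real.norm_natCast, Finset.sum_const, Finset.card_univ,
    Fintype.card_fin, nsmul_eq_mul] at h
  exact le_of_mul_le_mul_left h hN'

variable {M₁ M₂ M₃ : ℝ}

theorem isFeasible_of_linearIndependent
    (hgr₂ : ∀ i, IsGeneralizedRetraction M₁ M₂ M₃ (gr (r₂ i))) (hU : x.Uᵀ * x.U = 1)
    (hV : ∀ i, (x.Vhalf i)ᵀ * x.Vhalf i = 1)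
    (h : ∀ i, LinearIndependent ℝ (x.Vhalf i + -(x.U * x.Uᵀ * x.Vhalf i)).col) :
    x.IsFeasible gr :=
  ⟨hU, fun i => (hgr₂ i).fromCols_mem_stiefel hU (hV i) (h i)⟩

/-- One communication round preserves feasibility, and it increases the contribution of each
client to the objective function up to an error that is quadratic in the step. -/
theorem next_client (hM₁ : 0 ≤ M₁) (hM₂ : 0 ≤ M₂) (hM₃ : 0 < M₃)
    {r : ℕ} {G : ℝ} (hG : 0 ≤ G) (hN : 0 < N) (hη : 0 < η) (hr₁ : r₁ ≤ r) (hr₂ : ∀ i, r₂ i ≤ r)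
    (hstep : η * (G * √r) ≤ stepConst M₁ M₂ M₃)
    (hpsd : ∀ i, (S i).PosSemidef) (hS : ∀ i, opNorm (S i) ≤ G)
    (hgr₁ : IsGeneralizedRetraction M₁ M₂ M₃ (gr r₁))
    (hgr₂ : ∀ i, IsGeneralizedRetraction M₁ M₂ M₃ (gr (r₂ i)))
    (hx : x.IsFeasible gr) (i : Fin N) :
    Matrix.fromCols (x.next gr S η).U ((x.next gr S η).V gr i) ∈
        Stiefel d (Fin r₁ ⊕ Fin (r₂ i)) ∧
      2 * η * (((x.gradU gr S i)ᵀ * x.meanGradU gr S).trace + ‖x.gradV gr S i‖ ^ 2) -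
          η * (‖x.meanGradU gr S‖ ^ 2 + ‖x.gradV gr S i‖ ^ 2) ≤
        ((x.next gr S η).Uᵀ * S i * (x.next gr S η).U).trace +
          (((x.next gr S η).V gr i)ᵀ * S i * (x.next gr S η).V gr i).trace -
        ((x.Uᵀ * S i * x.U).trace + ((x.V gr i)ᵀ * S i * x.V gr i).trace) := by
  have hST : ∀ j, (S j)ᵀ = S j := fun j => by simpa using (hpsd j).isHermitian.eq
  obtain ⟨hc₁, hc₂, hc₃, hc₄, hc₅⟩ := stepConst_bounds hM₁ hM₂ hM₃
  have hK := displacementConst_nonneg hM₁ hM₂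
  obtain ⟨hU, hV, hUV⟩ := fromCols_mem_stiefel_iff.1 (hx.fromCols i)
  obtain ⟨-, hUg, hVg⟩ := transpose_mul_grad (S := S) hx i
  have hUm := transpose_mul_meanGradU (S := S) hx
  have ha : ‖η • x.meanGradU gr S‖ ≤ stepConst M₁ M₂ M₃ := by
    rw [norm_smul, Real.norm_of_nonneg hη.le]
    exact (mul_le_mul_of_nonneg_left (norm_meanGradU_le hN hr₁ hr₂ hS hx) hη.le).trans hstep
  have hb : ‖η • x.gradV gr S i‖ ≤ stepConst M₁ M₂ M₃ := by
    rw [norm_smul, Real.norm_of_nonneg hη.le]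
    exact (mul_le_mul_of_nonneg_left (norm_grad_le hr₁ hr₂ hS hx i).2 hη.le).trans hstep
  have hUa : x.Uᵀ * (η • x.meanGradU gr S) = 0 := by rw [Matrix.mul_smul, hUm, smul_zero]
  have hUb : x.Uᵀ * (η • x.gradV gr S i) = 0 := by rw [Matrix.mul_smul, hUg, smul_zero]
  have hVb : (x.V gr i)ᵀ * (η • x.gradV gr S i) = 0 := by rw [Matrix.mul_smul, hVg, smul_zero]
  have hfirst := trace_first_order (hST i) hUa hUb hVb
  have e₁ := hgr₁.norm_sub_add_le hU hUa (ha.trans hc₁)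
  have e₂ := (hgr₂ i).norm_sub_add_le hV hVb (hb.trans hc₁)
  have hU' := hgr₁.mem_stiefel x.U hU (η • x.meanGradU gr S)
  have hV' := (hgr₂ i).mem_stiefel (x.V gr i) hV (η • x.gradV gr S i)
  have hVdef : (x.next gr S η).V gr i = gr (r₂ i) ((x.next gr S η).Vhalf i)
    (-((x.next gr S η).U * ((x.next gr S η).U)ᵀ * (x.next gr S η).Vhalf i)) := rfl
  rw [← next_U (gr := gr) (x := x) (η := η) hN hST] at e₁ hU'
  rw [← next_Vhalf (gr := gr) (x := x) (η := η) hST] at e₂ hV'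
  have hcross := norm_transpose_mul_sub_le hU hV' hUV hUb (ha.trans hc₅) hM₁ e₁ e₂
  obtain ⟨hT₁, hT₂⟩ := norm_transpose_mul_le_of_sub_le (by positivity) hc₅ hV ha hb hcross
  have hfeas := (hgr₂ i).fromCols_mem_stiefel hU' hV'
    (linearIndependent_deflation_of_norm_lt hV' (hT₁.trans_lt hc₃))
  rw [← hVdef] at hfeas
  refine ⟨hfeas, ?_⟩
  have e₃ := (hgr₂ i).norm_deflation_sub_le hM₁ hM₂ hU' hV' (hT₁.trans hc₂) (hT₁.trans hc₃.le)
  rw [← hVdef] at e₃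
  have hdisp := norm_displacement_sub_le hM₁ hM₂ hU' hV (ha.trans hc₅) e₁ e₂ hcross hT₂ e₃
  rw [← sub_sub] at e₁
  have q₁ := trace_quadratic_sub_ge (hpsd i) (x.next gr S η).U x.U (η • x.meanGradU gr S)
  have q₂ := trace_quadratic_sub_ge (hpsd i) ((x.next gr S η).V gr i) (x.V gr i)
    (η • x.gradV gr S i - x.U * ((η • x.meanGradU gr S)ᵀ * x.V gr i))
  have b₁ := mul_le_mul (norm_mul_le_mul_sqrt hr₁ (hS i) hU) e₁ (norm_nonneg _) (by positivity)
  have b₂ := mul_le_mul (norm_mul_le_mul_sqrt (hr₂ i) (hS i) hV) hdisp (norm_nonneg _)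
    (by positivity)
  have hfirst' : (((1 - x.U * x.Uᵀ - x.V gr i * (x.V gr i)ᵀ) * S i * x.U)ᵀ *
        η • x.meanGradU gr S).trace +
      (((1 - x.U * x.Uᵀ - x.V gr i * (x.V gr i)ᵀ) * S i * x.V gr i)ᵀ *
        η • x.gradV gr S i).trace =
      η * (((x.gradU gr S i)ᵀ * x.meanGradU gr S).trace + ‖x.gradV gr S i‖ ^ 2) := by
    rw [frobenius_norm_sq, Matrix.mul_smul, Matrix.mul_smul, Matrix.trace_smul,
      Matrix.trace_smul, smul_eq_mul, smul_eq_mul, ← mul_add]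
    rfl
  rw [hfirst'] at hfirst
  -- The errors carry $\eta^2$; one factor $\eta$ is absorbed together with $G\sqrt r$ by the
  -- stepsize bound.
  have herr : G * √r * (M₁ * ‖η • x.meanGradU gr S‖ ^ 2) + G * √r * (displacementConst M₁ M₂ *
      (‖η • x.meanGradU gr S‖ ^ 2 + ‖η • x.gradV gr S i‖ ^ 2)) ≤
      η / 2 * (‖x.meanGradU gr S‖ ^ 2 + ‖x.gradV gr S i‖ ^ 2) := by
    rw [norm_smul, norm_smul, Real.norm_of_nonneg hη.le]
    set m := ‖x.meanGradU gr S‖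
    set v := ‖x.gradV gr S i‖
    have h1 : η * (G * √r) * (displacementConst M₁ M₂ + M₁) ≤ 1 / 2 :=
      (mul_le_mul_of_nonneg_right hstep (by positivity)).trans hc₄
    have h2 : 0 ≤ G * √r * (M₁ * (η * v) ^ 2) := by positivity
    calc _ ≤ η * (G * √r) * (displacementConst M₁ M₂ + M₁) * (η * (m ^ 2 + v ^ 2)) := by
          nlinarith
      _ ≤ 1 / 2 * (η * (m ^ 2 + v ^ 2)) := mul_le_mul_of_nonneg_right h1 (by positivity)
      _ = _ := by ring
  linarith

theorem next_isFeasible_and_energy (hM₁ : 0 ≤ M₁) (hM₂ : 0 ≤ M₂) (hM₃ : 0 < M₃)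
    {r : ℕ} {G : ℝ} (hG : 0 ≤ G) (hN : 0 < N) (hη : 0 < η) (hr₁ : r₁ ≤ r) (hr₂ : ∀ i, r₂ i ≤ r)
    (hstep : η * (G * √r) ≤ stepConst M₁ M₂ M₃)
    (hpsd : ∀ i, (S i).PosSemidef) (hS : ∀ i, opNorm (S i) ≤ G)
    (hgr₁ : IsGeneralizedRetraction M₁ M₂ M₃ (gr r₁))
    (hgr₂ : ∀ i, IsGeneralizedRetraction M₁ M₂ M₃ (gr (r₂ i)))
    (hx : x.IsFeasible gr) :
    (x.next gr S η).IsFeasible gr ∧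
      η * x.progress gr S ≤ (x.next gr S η).energy gr S - x.energy gr S := by
  have h := next_client hM₁ hM₂ hM₃ hG hN hη hr₁ hr₂ hstep hpsd hS hgr₁ hgr₂ hx
  refine ⟨⟨hgr₁.mem_stiefel _ hx.stiefel_U _, fun i => (h i).1⟩, ?_⟩
  -- The cross term of a single client may be negative; summed over the clients these terms give
  -- $N\|\cdot\|^2$ of the mean gradient.
  have hsum := Finset.sum_le_sum fun i (_ : i ∈ Finset.univ) => (h i).2
  rw [Finset.sum_sub_distrib, Finset.sum_sub_distrib, ← Finset.mul_sum, ← Finset.mul_sum,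
    Finset.sum_add_distrib, Finset.sum_add_distrib, ← Matrix.trace_sum, ← Matrix.sum_mul,
    ← Matrix.transpose_sum, ← N_smul_meanGradU hN, Matrix.transpose_smul, Matrix.smul_mul,
    Matrix.trace_smul, ← frobenius_norm_sq, Finset.sum_const, Finset.card_univ,
    Fintype.card_fin, nsmul_eq_mul, smul_eq_mul] at hsum
  rw [energy, energy, progress]
  linarith

theorem energy_nonneg (hpsd : ∀ i, (S i).PosSemidef) : 0 ≤ x.energy gr S := by
  refine Finset.sum_nonneg fun i _ => add_nonneg ?_ ?_
  · simpa using ((hpsd i).conjTranspose_mul_mul_same x.U).trace_nonneg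
  · simpa using ((hpsd i).conjTranspose_mul_mul_same (x.V gr i)).trace_nonneg

theorem energy_le {r : ℕ} {G : ℝ} (hr₁ : r₁ ≤ r) (hr₂ : ∀ i, r₂ i ≤ r)
    (hS : ∀ i, opNorm (S i) ≤ G) (hx : x.IsFeasible gr) :
    x.energy gr S ≤ 2 * N * G * r := by
  have hA : ∀ {k : ℕ} (_ : k ≤ r) (i : Fin N) {A : Matrix (Fin d) (Fin k) ℝ} (_ : Aᵀ * A = 1),
      (Aᵀ * S i * A).trace ≤ G * r := by
    intro k hk i A hA
    have hG : 0 ≤ G := (norm_nonneg _).trans (hS i)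
    rw [Matrix.mul_assoc]
    calc _ ≤ ‖A‖ * ‖S i * A‖ := (le_abs_self _).trans (abs_trace_transpose_mul_le _ _)
      _ ≤ √r * (G * √r) := mul_le_mul (norm_le_sqrt_of_orthonormal hk hA)
        (norm_mul_le_mul_sqrt hk (hS i) hA) (norm_nonneg _) (Real.sqrt_nonneg _)
      _ = G * (√r * √r) := by ring
      _ = G * r := by rw [Real.mul_self_sqrt (Nat.cast_nonneg r)]
  calc x.energy gr S ≤ ∑ _i : Fin N, (G * r + G * r) := by
        refine Finset.sum_le_sum fun i _ => ?_
        obtain ⟨hU, hV, -⟩ := fromCols_mem_stiefel_iff.1 (hx.fromCols i)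
        exact add_le_add (hA hr₁ i hU) (hA (hr₂ i) i hV)
    _ = 2 * N * G * r := by
        rw [Finset.sum_const, Finset.card_univ, Fintype.card_fin, nsmul_eq_mul]
        ring

end State

end PerPCA

/-! ### Telescoping and the rate. -/

theorem theorem2 (M₁ M₂ M₃ : ℝ) (hM₁ : 0 ≤ M₁) (hM₂ : 0 ≤ M₂) (hM₃ : 0 < M₃) :
    -- the constant in the stepsize condition depends only on the retraction constants
    ∃ c : ℝ, 0 < c ∧
      ∀ (d N r₁ : ℕ) (r₂ : Fin N → ℕ) (G η : ℝ), 0 < N → 0 < G → 0 < η →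
        η ≤ c / (G * Real.sqrt (PerPCA.maxRank r₁ r₂ : ℝ)) →
        ∃ C : ℝ, 0 < C ∧
          ∀ (S : Fin N → Matrix (Fin d) (Fin d) ℝ)
            (gr : (k : ℕ) → Matrix (Fin d) (Fin k) ℝ → Matrix (Fin d) (Fin k) ℝ →
              Matrix (Fin d) (Fin k) ℝ)
            (x : PerPCA.State d N r₁ r₂),
            (∀ i, (S i).PosSemidef) →
            (∀ i, PerPCA.opNorm (S i) ≤ G) →
            PerPCA.IsGeneralizedRetraction M₁ M₂ M₃ (gr r₁) →
            (∀ i, PerPCA.IsGeneralizedRetraction M₁ M₂ M₃ (gr (r₂ i))) →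
            -- the initialization
            x.U ∈ PerPCA.Stiefel d (Fin r₁) →
            (∀ i, x.Vhalf i ∈ PerPCA.Stiefel d (Fin (r₂ i))) →
            (∀ i, LinearIndependent ℝ (Matrix.fromCols x.U (x.Vhalf i)).col) →
            -- all iterates are feasible
            (∀ k : ℕ, ∀ i,
              Matrix.fromCols (PerPCA.run gr S η x k).U ((PerPCA.run gr S η x k).V gr i) ∈
                PerPCA.Stiefel d (Fin r₁ ⊕ Fin (r₂ i))) ∧
            -- the rate; the index `k` stands for communication round `k + 1`
            ∀ (R : ℕ) (hR : 0 < R),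
              (Finset.range R).inf' (Finset.nonempty_range_iff.mpr hR.ne')
                (fun k => (PerPCA.run gr S η x k).kktViolation gr S) ≤ C / (R : ℝ) := by
  refine ⟨PerPCA.stepConst M₁ M₂ M₃, PerPCA.stepConst_pos hM₁ hM₂ hM₃, ?_⟩
  intro d N r₁ r₂ G η hN hG hη hstep
  set r := PerPCA.maxRank r₁ r₂ with hr
  have hr₁ : r₁ ≤ r := le_max_left _ _
  have hr₂ : ∀ i, r₂ i ≤ r := fun i =>
    (Finset.le_sup (f := r₂) (Finset.mem_univ i)).trans (le_max_right _ _)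
  have hrpos : (0 : ℝ) < r := by
    rcases (Nat.cast_nonneg (α := ℝ) r).eq_or_lt with h | h
    -- For $r=0$ the stepsize bound is a division by zero, with value $0$, contradicting $\eta>0$.
    · rw [← h] at hstep
      simp at hstep
      linarith
    · exact h
  rw [le_div_iff₀ (by positivity)] at hstep
  have hNpos : (0 : ℝ) < N := by exact_mod_cast hN
  -- The energy range $2NGr$ over the gain factor $\eta$, times the $N$ of `kktViolation_le`.
  refine ⟨N * (2 * N * G * r) / η, by positivity, ?_⟩
  intro S gr x hpsd hS hgr₁ hgr₂ hU hV hlin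
  have hfeas : ∀ k, (PerPCA.run gr S η x k).IsFeasible gr := by
    intro k
    induction k with
    | zero =>
      exact PerPCA.State.isFeasible_of_linearIndependent hgr₂ hU hV fun i =>
        PerPCA.linearIndependent_deflation_of_fromCols (hlin i)
    | succ k ih =>
      exact (PerPCA.State.next_isFeasible_and_energy hM₁ hM₂ hM₃ hG.le hN hη hr₁ hr₂ hstep
        hpsd hS hgr₁ hgr₂ ih).1
  refine ⟨fun k => (hfeas k).fromCols, fun R hR => ?_⟩
  have hR' : (0 : ℝ) < R := by exact_mod_cast hR
  have hsum : ∑ k ∈ Finset.range R, η * (PerPCA.run gr S η x k).progress gr S ≤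
      2 * N * G * r := by
    have h1 : ∑ k ∈ Finset.range R, η * (PerPCA.run gr S η x k).progress gr S ≤
        ∑ k ∈ Finset.range R, ((PerPCA.run gr S η x (k + 1)).energy gr S -
          (PerPCA.run gr S η x k).energy gr S) :=
      Finset.sum_le_sum fun k _ => (PerPCA.State.next_isFeasible_and_energy hM₁ hM₂ hM₃ hG.le hN
        hη hr₁ hr₂ hstep hpsd hS hgr₁ hgr₂ (hfeas k)).2
    rw [Finset.sum_range_sub fun k => (PerPCA.run gr S η x k).energy gr S] at h1
    have h2 := PerPCA.State.energy_le hr₁ hr₂ hS (hfeas R)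
    have h3 : 0 ≤ (PerPCA.run gr S η x 0).energy gr S := PerPCA.State.energy_nonneg hpsd
    linarith
  set m := (Finset.range R).inf' (Finset.nonempty_range_iff.mpr hR.ne')
    (fun k => (PerPCA.run gr S η x k).kktViolation gr S)
  have hm : (R : ℝ) * m ≤
      ∑ k ∈ Finset.range R, N * (PerPCA.run gr S η x k).progress gr S := by
    have h := Finset.card_nsmul_le_sum (Finset.range R)
      (fun k => N * (PerPCA.run gr S η x k).progress gr S) m fun k hk =>
        (Finset.inf'_le _ hk).trans (PerPCA.State.kktViolation_le hN)
    rwa [Finset.card_range, nsmul_eq_mul] at h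
  rw [← Finset.mul_sum] at hsum hm
  rw [le_div_iff₀ hR', le_div_iff₀ hη]
  calc m * R * η = (R * m) * η := by ring
    _ ≤ (N * ∑ k ∈ Finset.range R, (PerPCA.run gr S η x k).progress gr S) * η := by gcongr
    _ = N * (η * ∑ k ∈ Finset.range R, (PerPCA.run gr S η x k).progress gr S) := by ring
    _ ≤ N * (2 * N * G * r) := by gcongr
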